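/- For a permutation $\pi$ of $[n]=\{1,\dots,n\}$, write $\pi$ in standard cycle form (the smallest element of each cycle, fixed points included, is written first, and the cycles are arranged in increasing order of their smallest elements), and let $\mathrm{Flatten}(\pi)$ be the word of length $n$ obtained by erasing the parentheses. An occurrence of the pattern $31\text{-}2$ in a word $w_1w_2\cdots w_n$ is a pair of indices $2\le i<j\le n$ with $w_i<w_j<w_{i-1}$. Let $g_{n,r}$ be the number of permutations $\pi$ of $[n]$ such that $\mathrm{Flatten}(\pi)$ has exactly $r$ occurrences of $31\text{-}2$, and put \[ G_r^{31\text{-}2}(x)=\sum_{n\ge 3} g_{n,r}\,x^n . \] Then for $0\le r\le 3$, as an identity of formal Laurent series over $\mathbb{Q}$ (where $\sqrt{f}$ denotes the square root with constant term $1$ of a power series $f$ with constant term $1$), \[ G_r^{31\text{-}2}(x)=\frac{a_r(x)+b_r(x)\sqrt{1-4x}}{\sqrt{(1-4x)^{2r+1}}}, \] where (i) $a_0(x)=x$, $\ b_0(x)=-x-2x^2$; (ii) $a_1(x)=\frac1x(3x-1)(1-5x+2x^2)$, $\ b_1(x)=\frac1x(1-6x+7x^2)$; (iii) $a_2(x)=\frac1x(1-12x+50x^2-76x^3+22x^4)$,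 $\ b_2(x)=\frac1x(-1+10x-32x^2+28x^3)$; (iv) $a_3(x)=\frac1{x^2}(2-37x+270x^2-972x^3+1748x^4-1346x^5+220x^6)$, $\ b_3(x)=\frac1{x^2}(-2+33x-208x^2+614x^3-824x^4+368x^5)$. Moreover, for $1\le r\le 3$ the sum may equally be started at $n=2$: $\sum_{n\ge 2} g_{n,r}\,x^n=G_r^{31\text{-}2}(x)$. -/

import Mathlib

open PowerSeries LaurentSeries

namespace Flatten

/-- The word `Flatten(π)`: the minimal elements of the cycles of `π` (fixed points included) are
listed in increasing order, and each of them is expanded to its cycle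
`i, π i, π (π i), …`, written once around. Letters are `0, …, n - 1` instead of `1, …, n`. -/
def flatten {n : ℕ} (π : Equiv.Perm (Fin n)) : List (Fin n) :=
  ((List.finRange n).filter fun i => ∀ j, π.SameCycle i j → i ≤ j).flatMap fun i =>
    List.iterate π i (Finset.univ.filter fun j => π.SameCycle i j).card

/-- The number of occurrences of the pattern `31-2` in the word `w`: triples of positions
`i`, `i + 1`, `j` with `i + 1 < j` such that `w i`, `w (i + 1)`, `w j` is order-isomorphic
to `3`, `1`, `2`. -/
def occ {n : ℕ} (w : List (Fin n)) : ℕ :=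
  (Finset.univ.filter fun t : Fin w.length × Fin w.length × Fin w.length =>
    (t.2.1 : ℕ) = t.1 + 1 ∧ t.2.1 < t.2.2 ∧
      w.get t.2.1 < w.get t.2.2 ∧ w.get t.2.2 < w.get t.1).card

/-- The number of permutations `π` of length `n` such that `Flatten(π)` has exactly `r`
occurrences of `31-2`. -/
def count (n r : ℕ) : ℕ :=
  (Finset.univ.filter fun π : Equiv.Perm (Fin n) => occ (flatten π) = r).card

/-- The generating function `∑_{n ≥ m} count n r * x ^ n`. -/
def genFun (m r : ℕ) : ℚ⟦X⟧ :=
  PowerSeries.mk fun n => if m ≤ n then (count n r : ℚ) else 0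

/-- The square root `√f = ∑ₖ (1/2 choose k) (f - 1) ^ k` of a power series `f` with constant
term `1`; it is the only square root of `f` with constant term `1`. -/
noncomputable def sqrtSeries (f : ℚ⟦X⟧) : ℚ⟦X⟧ :=
  (PowerSeries.binomialSeries ℚ (1 / 2 : ℚ)).subst (f - 1)

theorem hasSubst_sub_one {f : ℚ⟦X⟧} (hf : constantCoeff f = 1) : HasSubst (f - 1) :=
  HasSubst.of_constantCoeff_zero' (by simp [hf])

theorem sqrtSeries_mul_self {f : ℚ⟦X⟧} (hf : constantCoeff f = 1) :
    sqrtSeries f * sqrtSeries f = f := by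
  have h := hasSubst_sub_one hf
  unfold sqrtSeries
  rw [← subst_mul h, ← PowerSeries.binomialSeries_add]
  have h1 : PowerSeries.binomialSeries ℚ ((1 / 2 : ℚ) + 1 / 2) = 1 + X := by
    have := PowerSeries.binomialSeries_nat (R := ℚ) (A := ℚ) 1
    norm_num at this ⊢
    exact this
  rw [h1, subst_add h, subst_X h]
  have h2 : (1 : ℚ⟦X⟧).subst (f - 1) = (1 : ℚ⟦X⟧) := by
    rw [← coe_substAlgHom h, map_one]
  rw [h2]
  ring

theorem constantCoeff_sqrtSeries {f : ℚ⟦X⟧} (hf : constantCoeff f = 1) :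
    constantCoeff (sqrtSeries f) = 1 := by
  have h := hasSubst_sub_one hf
  have h0 : constantCoeff (f - 1) = 0 := by simp [hf]
  set B : ℚ⟦X⟧ := PowerSeries.binomialSeries ℚ (1 / 2 : ℚ) with hB
  have hc : constantCoeff (B - 1) = 0 := by
    rw [map_sub, hB, PowerSeries.binomialSeries_constantCoeff]; simp
  have h1 : sqrtSeries f = 1 + (B - 1).subst (f - 1) := by
    have h2 : (1 : ℚ⟦X⟧).subst (f - 1) = (1 : ℚ⟦X⟧) := by
      rw [← coe_substAlgHom h, map_one]
    have h3 : B = 1 + (B - 1) := by ring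
    unfold sqrtSeries
    rw [← hB]
    conv_lhs => rw [h3]
    rw [subst_add h, h2]
  have h4 : constantCoeff ((B - 1).subst (f - 1) : ℚ⟦X⟧) = 0 :=
    constantCoeff_subst_eq_zero h0 _ hc
  rw [h1, map_add, map_one, h4, add_zero]

noncomputable section

/-- The rational functions `a₀, a₁, a₂, a₃`. -/
def a : Fin 4 → RatFunc ℚ :=
  let x : RatFunc ℚ := RatFunc.X
  ![x,
    1 / x * ((3 * x - 1) * (1 - 5 * x + 2 * x ^ 2)),
    1 / x * (1 - 12 * x + 50 * x ^ 2 - 76 * x ^ 3 + 22 * x ^ 4),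
    1 / x ^ 2 * (2 - 37 * x + 270 * x ^ 2 - 972 * x ^ 3 + 1748 * x ^ 4 - 1346 * x ^ 5
      + 220 * x ^ 6)]

/-- The rational functions `b₀, b₁, b₂, b₃`. -/
def b : Fin 4 → RatFunc ℚ :=
  let x : RatFunc ℚ := RatFunc.X
  ![-x - 2 * x ^ 2,
    1 / x * (1 - 6 * x + 7 * x ^ 2),
    1 / x * (-1 + 10 * x - 32 * x ^ 2 + 28 * x ^ 3),
    1 / x ^ 2 * (-2 + 33 * x - 208 * x ^ 2 + 614 * x ^ 3 - 824 * x ^ 4 + 368 * x ^ 5)]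

end

end Flatten

/-! Flattening is a greedy walk: after the letter `a` comes `π a` if that letter is still unused,
and otherwise, the cycle being closed, the smallest unused letter (`flatten_eq_walk`). Summed over
all permutations, each unused letter is the successor in one way through the value `π a`, and the
smallest one in a second way through closing the cycle. A step from `a` to `b` creates one
occurrence for every unused letter strictly between `b` and `a`. So the total weight `q ^ occ` of
what remains depends only on the number of unused letters and on the rank of the current letter
among them: this is the recursion `rankSum`, and `sum_pow_occ_flatten` identifies its value at rank
0 with the counting polynomial.

Marking the rank by a power of `v` turns the recursion into a functional equation
(`kernel_firstPoly`) whose unknowns are the wanted sums `rankSum q (k + 1) 0` and a boundary term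
`topSum`. The kernel method takes `v` on the curve `(v - 1) * (1 - q * v) = x * (1 - q) * v ^ 2`,
where the sum over `k` telescopes. The boundary term always carries a factor `q`, and modulo `q ^ 4`
it obeys a linear recurrence of order three (`topSum_rec`), so its generating function is rational
to the precision required by `r ≤ 3`. This gives a closed equation (`kernel_method`) in `w = 1 / v`,
where `(1 - w) * (w - q) = x * (1 - q)`. Writing `s = √(1 - 4x)`, so that `x = (1 - s ^ 2) / 4`, and
expanding the root `w` through `q ^ 3`, the coefficients of `q ^ 0, …, q ^ 3` become rational
functions of `s` (`hasCoeffs_of_kernel`), and the theorem is an identity between these. -/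

namespace Flatten

/-! ### Greedy walks, occurrences along them, and ranks -/

section Walk

variable {α : Type*} [LinearOrder α]

/-- The minimum of `S`, with default value `a` when `S` is empty. -/
def minD (S : Finset α) (a : α) : α := if h : S.Nonempty then S.min' h else a

/-- The letter following `a` in a flattened permutation when the letters in `S` are still
unused. -/
def next (π : Equiv.Perm α) (S : Finset α) (a : α) : α := if π a ∈ S then π a else minD S a

/-- The part of a flattened permutation that starts with `a` and uses the letters of `S`
afterwards, `k` being the number of elements of `S`. -/
def walk (π : Equiv.Perm α) : ℕ → Finset α → α → List α
  | 0, _, a => [a]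
  | k + 1, S, a => a :: walk π k (S.erase (next π S a)) (next π S a)

theorem minD_mem {S : Finset α} (hS : S.Nonempty) (a : α) : minD S a ∈ S := by
  rw [minD, dif_pos hS]; exact S.min'_mem hS

theorem minD_eq_iff {S : Finset α} {a b : α} (hb : b ∈ S) :
    minD S a = b ↔ ∀ c ∈ S, b ≤ c := by
  have hS : S.Nonempty := ⟨b, hb⟩
  rw [minD, dif_pos hS]
  constructor
  · rintro rfl c hc
    exact S.min'_le c hc
  · intro h
    exact le_antisymm (S.min'_le b hb) (h _ (S.min'_mem hS))

theorem next_mem {S : Finset α} (hS : S.Nonempty) (π : Equiv.Perm α) (a : α) :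
    next π S a ∈ S := by
  unfold next
  split_ifs with h
  · exact h
  · exact minD_mem hS a

theorem walk_eq_cons (π : Equiv.Perm α) (k : ℕ) (S : Finset α) (a : α) :
    ∃ l, walk π k S a = a :: l := by
  cases k <;> exact ⟨_, rfl⟩

/-- The walk sees a value of `π` only if it is unused; all used values act alike, by forcing a jump
to the minimum. Exchanging two used values therefore changes nothing. -/
theorem walk_swap_mul {a b : α} (π : Equiv.Perm α) (k : ℕ) (S : Finset α) (c : α)
    (ha : a ∉ S) (hb : b ∉ S) : walk (Equiv.swap a b * π) k S c = walk π k S c := by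
  induction k generalizing S c with
  | zero => rfl
  | succ k ih =>
    have hn : next (Equiv.swap a b * π) S c = next π S c := by
      unfold next
      rw [Equiv.Perm.mul_apply]
      by_cases h1 : π c = a
      · simp [h1, ha, hb]
      by_cases h2 : π c = b
      · simp [h2, ha, hb]
      rw [Equiv.swap_apply_of_ne_of_ne h1 h2]
    rw [walk, walk, hn, ih _ _ (fun h => ha (Finset.mem_of_mem_erase h))
      (fun h => hb (Finset.mem_of_mem_erase h))]

/-- Whatever `π` is, the walk visits each letter of `insert a S` exactly once, so counts of later
letters do not depend on their order. -/
theorem countP_walk (p : α → Prop) [DecidablePred p] (π : Equiv.Perm α) (k : ℕ) (S : Finset α)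
    (a : α) (hk : S.card = k) (ha : a ∉ S) :
    (walk π k S a).countP p = ((insert a S).filter p).card := by
  induction k generalizing S a with
  | zero =>
    obtain rfl := Finset.card_eq_zero.mp hk
    simp [walk, Finset.filter_singleton, List.countP_cons]
    split_ifs <;> simp
  | succ k ih =>
    have hS : S.Nonempty := Finset.card_pos.mp (by omega)
    have hm := next_mem hS π a
    rw [walk, List.countP_cons, ih _ _ (by rw [Finset.card_erase_of_mem hm, hk]; rfl)
      (Finset.notMem_erase _ _), Finset.insert_erase hm, Finset.filter_insert]
    by_cases h : p a
    · have : a ∉ S.filter p := fun h' => ha (Finset.mem_filter.mp h').1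
      simp [h, Finset.card_insert_of_notMem this]
    · simp [h]

/-- The number of occurrences of `31-2` in a word, by recursion on the word. -/
def occRec : List α → ℕ
  | [] => 0
  | [_] => 0
  | a :: b :: l => (b :: l).countP (fun c => b < c ∧ c < a) + occRec (b :: l)

theorem occRec_cons_walk (π : Equiv.Perm α) (k : ℕ) (S : Finset α) (a b : α) (hb : b ∈ S)
    (hk : S.card = k + 1) :
    occRec (a :: walk π k (S.erase b) b) =
      (S.filter fun c => b < c ∧ c < a).card + occRec (walk π k (S.erase b) b) := by
  have h := countP_walk (fun c => b < c ∧ c < a) π k (S.erase b) b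
    (by rw [Finset.card_erase_of_mem hb, hk]; rfl) (Finset.notMem_erase _ _)
  rw [Finset.insert_erase hb] at h
  obtain ⟨l, hl⟩ := walk_eq_cons π k (S.erase b) b
  rw [← h, hl, occRec]

/-- The number of elements of `S` below `a`. -/
def rankIn (S : Finset α) (a : α) : ℕ := (S.filter (· < a)).card

theorem rankIn_lt_rankIn {S : Finset α} {a b : α} (hb : b ∈ S) (h : b < a) :
    rankIn S b < rankIn S a := by
  refine Finset.card_lt_card (Finset.ssubset_iff_of_subset ?_ |>.mpr ⟨b, ?_, ?_⟩)
  · exact fun c hc => Finset.mem_filter.mpr ⟨(Finset.mem_filter.mp hc).1,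
      (Finset.mem_filter.mp hc).2.trans h⟩
  · simp [hb, h]
  · simp

theorem rankIn_le_rankIn {S : Finset α} {a b : α} (h : a ≤ b) : rankIn S a ≤ rankIn S b :=
  Finset.card_le_card fun _ hc => Finset.mem_filter.mpr ⟨(Finset.mem_filter.mp hc).1,
      (Finset.mem_filter.mp hc).2.trans_le h⟩

/-- The rank is strictly monotone on `S`, hence a bijection onto an initial segment of `ℕ`. -/
theorem sum_rankIn {M : Type*} [AddCommMonoid M] (S : Finset α) (f : ℕ → M) :
    ∑ b ∈ S, f (rankIn S b) = ∑ i ∈ Finset.range S.card, f i := by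
  have hinj : Set.InjOn (rankIn S) S := by
    intro a ha b hb h
    rcases lt_trichotomy a b with h' | h' | h'
    · exact absurd h (rankIn_lt_rankIn ha h').ne
    · exact h'
    · exact absurd h (rankIn_lt_rankIn hb h').ne'
  rw [← Finset.sum_image hinj]
  congr 1
  refine Finset.eq_of_subset_of_card_le ?_ ?_
  · intro i hi
    obtain ⟨b, hb, rfl⟩ := Finset.mem_image.mp hi
    refine Finset.mem_range.mpr (Finset.card_lt_card ?_)
    exact Finset.ssubset_iff_of_subset (Finset.filter_subset _ _) |>.mpr ⟨b, hb, by simp⟩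
  · rw [Finset.card_range, Finset.card_image_of_injOn hinj]

end Walk

/-! ### Summing over permutations: reduction to a recursion on ranks -/

section WeightSum

variable {α : Type*} [LinearOrder α] [Fintype α] {R : Type*} [CommRing R]

/-- The permutations that fix everything outside `S`. -/
def permsOn (S : Finset α) : Finset (Equiv.Perm α) :=
  Finset.univ.filter fun π => ∀ i, i ∉ S → π i = i

theorem mem_permsOn {S : Finset α} {π : Equiv.Perm α} :
    π ∈ permsOn S ↔ ∀ i, i ∉ S → π i = i := by simp [permsOn]

theorem apply_mem_of_mem_permsOn {S : Finset α} {π : Equiv.Perm α} (h : π ∈ permsOn S) {a : α}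
    (ha : a ∈ S) : π a ∈ S := by
  by_contra hn
  have := mem_permsOn.mp h _ hn
  rw [π.injective this] at hn
  exact hn ha

/-- A permutation `π` is determined by `c = π a` together with `swap a c * π`, which fixes `a`. -/
theorem sum_permsOn_insert {M : Type*} [AddCommMonoid M] {S : Finset α} {a : α} (ha : a ∉ S)
    (f : Equiv.Perm α → M) :
    ∑ π ∈ permsOn (insert a S), f π =
      ∑ c ∈ insert a S, ∑ π ∈ permsOn S, f (Equiv.swap a c * π) := by
  rw [← Finset.sum_product']
  refine Finset.sum_bij' (fun π _ => (π a, Equiv.swap a (π a) * π))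
    (fun p _ => Equiv.swap a p.1 * p.2) ?_ ?_ ?_ ?_ ?_
  · intro π hπ
    refine Finset.mem_product.mpr ⟨apply_mem_of_mem_permsOn hπ (Finset.mem_insert_self _ _),
      mem_permsOn.mpr fun i hi => ?_⟩
    by_cases hia : i = a
    · subst hia; simp
    · have h1 := mem_permsOn.mp hπ i (by simp [hia, hi])
      have h2 : i ≠ π a := fun h => hia (π.injective (h1.trans h))
      rw [Equiv.Perm.mul_apply, h1, Equiv.swap_apply_of_ne_of_ne hia h2]
  · rintro ⟨c, π⟩ hp
    obtain ⟨hc, hπ⟩ := Finset.mem_product.mp hp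
    refine mem_permsOn.mpr fun i hi => ?_
    have h1 := mem_permsOn.mp hπ i (fun h => hi (Finset.mem_insert_of_mem h))
    rw [Equiv.Perm.mul_apply, h1, Equiv.swap_apply_of_ne_of_ne]
    · rintro rfl; exact hi (Finset.mem_insert_self _ _)
    · rintro rfl; exact hi hc
  · intro π _
    simp [← mul_assoc]
  · rintro ⟨c, π⟩ hp
    obtain ⟨hc, hπ⟩ := Finset.mem_product.mp hp
    have h1 := mem_permsOn.mp hπ a ha
    simp [h1, ← mul_assoc]
  · intro π _
    simp [← mul_assoc]

/-- The sum of `q ^ occ` over all partially flattened permutations starting with `a` and using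
the letters of `S` afterwards. -/
def walkSum (q : R) (k : ℕ) (S : Finset α) (a : α) : R :=
  ∑ π ∈ permsOn (insert a S), q ^ occRec (walk π k S a)

theorem walkSum_zero (q : R) (a : α) : walkSum q 0 ∅ a = 1 := by
  have : permsOn (insert a (∅ : Finset α)) = {1} := by
    ext π
    simp only [mem_permsOn, Finset.mem_singleton]
    constructor
    · intro h
      ext i
      by_cases hi : i = a
      · subst hi
        by_contra hn
        have := h (π i) (by simpa using hn)
        exact hn (π.injective this)
      · exact h i (by simpa using hi)
    · rintro rfl i _; rfl
  rw [walkSum, this]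
  simp [walk, occRec]

/-- Split by the value at `a`. A value `b ∈ S` is itself the next letter; the value `a` closes the
cycle and sends the walk to the minimum of `S`. The minimum is thus reached twice, whence the factor
2. -/
theorem walkSum_succ (q : R) (k : ℕ) (S : Finset α) (a : α) (hk : S.card = k + 1) (ha : a ∉ S) :
    walkSum q (k + 1) S a = ∑ b ∈ S, q ^ (S.filter fun c => b < c ∧ c < a).card *
      ((if ∀ c ∈ S, b ≤ c then 2 else 1) * walkSum q k (S.erase b) b) := by
  have hS : S.Nonempty := Finset.card_pos.mp (by omega)
  have key : ∀ b ∈ S, ∑ π ∈ permsOn S, q ^ occRec (a :: walk π k (S.erase b) b) =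
      q ^ (S.filter fun c => b < c ∧ c < a).card * walkSum q k (S.erase b) b := by
    intro b hb
    rw [walkSum, Finset.insert_erase hb, Finset.mul_sum]
    refine Finset.sum_congr rfl fun π _ => ?_
    rw [occRec_cons_walk π k S a b hb hk, pow_add]
  have hfix : ∑ π ∈ permsOn S, q ^ occRec (walk (Equiv.swap a a * π) (k + 1) S a) =
      q ^ (S.filter fun c => minD S a < c ∧ c < a).card *
        walkSum q k (S.erase (minD S a)) (minD S a) := by
    rw [← key _ (minD_mem hS a)]
    refine Finset.sum_congr rfl fun π hπ => ?_
    have h1 : next π S a = minD S a := by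
      rw [next, if_neg]
      rwa [mem_permsOn.mp hπ a ha]
    have h2 : Equiv.swap a a * π = π := by rw [Equiv.swap_self]; rfl
    rw [h2, walk, h1]
  have hmov : ∀ b ∈ S, ∑ π ∈ permsOn S, q ^ occRec (walk (Equiv.swap a b * π) (k + 1) S a) =
      q ^ (S.filter fun c => b < c ∧ c < a).card * walkSum q k (S.erase b) b := by
    intro b hb
    rw [← key b hb]
    refine Finset.sum_congr rfl fun π hπ => ?_
    have h1 : next (Equiv.swap a b * π) S a = b := by
      rw [next, Equiv.Perm.mul_apply, mem_permsOn.mp hπ a ha, Equiv.swap_apply_left, if_pos hb]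
    rw [walk, h1, walk_swap_mul _ _ _ _ (fun h => ha (Finset.mem_of_mem_erase h))
      (Finset.notMem_erase _ _)]
  rw [walkSum, sum_permsOn_insert ha, Finset.sum_insert ha, hfix, Finset.sum_congr rfl hmov]
  have hsplit : ∀ b ∈ S, q ^ (S.filter fun c => b < c ∧ c < a).card *
      ((if ∀ c ∈ S, b ≤ c then 2 else 1) * walkSum q k (S.erase b) b) =
      (if b = minD S a then q ^ (S.filter fun c => minD S a < c ∧ c < a).card *
        walkSum q k (S.erase (minD S a)) (minD S a) else 0) +
      q ^ (S.filter fun c => b < c ∧ c < a).card * walkSum q k (S.erase b) b := by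
    intro b hb
    by_cases h : minD S a = b
    · rw [if_pos ((minD_eq_iff hb).mp h), if_pos h.symm, h]; ring
    · rw [if_neg (fun h' => h ((minD_eq_iff hb).mpr h')), if_neg (Ne.symm h)]; ring
  rw [Finset.sum_congr rfl hsplit, Finset.sum_add_distrib, Finset.sum_ite_eq' S,
    if_pos (minD_mem hS a)]

/-- The generating polynomial of partially flattened permutations with `k` letters after the
first one, of which `i` are smaller than the first one. -/
def rankSum (q : R) : ℕ → ℕ → R
  | 0, _ => 1
  | k + 1, i => ∑ b ∈ Finset.range (k + 1),
      (if b < i then q ^ (i - 1 - b) else 1) * ((if b = 0 then 2 else 1) * rankSum q k b)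

theorem walkSum_eq_rankSum (q : R) (k : ℕ) (S : Finset α) (a : α) (hk : S.card = k)
    (ha : a ∉ S) : walkSum q k S a = rankSum q k (rankIn S a) := by
  induction k generalizing S a with
  | zero =>
    obtain rfl := Finset.card_eq_zero.mp hk
    rw [walkSum_zero, rankSum]
  | succ k ih =>
    rw [walkSum_succ q k S a hk ha, rankSum, ← hk, ← sum_rankIn]
    refine Finset.sum_congr rfl fun b hb => ?_
    have h1 : rankIn (S.erase b) b = rankIn S b := by
      unfold rankIn
      congr 1
      ext c
      simp only [Finset.mem_filter, Finset.mem_erase]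
      exact ⟨fun h => ⟨h.1.2, h.2⟩, fun h => ⟨⟨h.2.ne, h.1⟩, h.2⟩⟩
    have h2 : (∀ c ∈ S, b ≤ c) ↔ rankIn S b = 0 := by
      simp [rankIn, Finset.filter_eq_empty_iff]
    have hab : a ≠ b := fun h => ha (h ▸ hb)
    -- If `b < a`, the letters below `a` are those below `b`, then `b` itself, then those strictly
    -- between; the exponent is a difference of ranks minus one.
    have h3 : q ^ (S.filter fun c => b < c ∧ c < a).card =
        if rankIn S b < rankIn S a then q ^ (rankIn S a - 1 - rankIn S b) else 1 := by
      rcases lt_or_gt_of_ne hab with h | h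
      · rw [if_neg (not_lt.mpr (rankIn_le_rankIn h.le)), Finset.filter_eq_empty_iff.mpr]
        · simp
        · exact fun c _ hc => absurd (hc.1.trans hc.2) h.asymm
      · rw [if_pos (rankIn_lt_rankIn hb h)]
        congr 1
        have h4 : S.filter (· < a) =
            insert b (S.filter (· < b) ∪ S.filter fun c => b < c ∧ c < a) := by
          ext c
          simp only [Finset.mem_filter, Finset.mem_insert, Finset.mem_union]
          constructor
          · rintro ⟨h5, h6⟩
            rcases lt_trichotomy c b with h' | h' | h'
            · exact Or.inr (Or.inl ⟨h5, h'⟩)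
            · exact Or.inl h'
            · exact Or.inr (Or.inr ⟨h5, h', h6⟩)
          · rintro (rfl | h' | h')
            · exact ⟨hb, h⟩
            · exact ⟨h'.1, h'.2.trans h⟩
            · exact ⟨h'.1, h'.2.2⟩
        have h5 : rankIn S a = rankIn S b + (S.filter fun c => b < c ∧ c < a).card + 1 := by
          rw [rankIn, h4, Finset.card_insert_of_notMem (by simp), Finset.card_union_of_disjoint]
          · rfl
          · rw [Finset.disjoint_left]
            intro c hc hc'
            exact (Finset.mem_filter.mp hc).2.asymm (Finset.mem_filter.mp hc').2.1
        omega
    rw [h3, ih _ _ (by rw [Finset.card_erase_of_mem hb, hk]; rfl) (Finset.notMem_erase _ _), h1]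
    simp only [h2]

end WeightSum

/-! ### Positional and recursive counts of occurrences agree -/

theorem occ_eq_sum {n : ℕ} (w : List (Fin n)) :
    occ w = ∑ i : Fin w.length, ∑ j : Fin w.length, ∑ k : Fin w.length,
      if (j : ℕ) = i + 1 ∧ j < k ∧ w.get j < w.get k ∧ w.get k < w.get i then 1 else 0 := by
  rw [occ, Finset.card_filter, Fintype.sum_prod_type]
  refine Finset.sum_congr rfl fun i _ => ?_
  rw [Fintype.sum_prod_type]

theorem countP_eq_sum_get {α : Type*} (p : α → Prop) [DecidablePred p] (l : List α) :
    l.countP p = ∑ k : Fin l.length, if p (l.get k) then 1 else 0 := by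
  induction l with
  | nil => simp
  | cons a l ih =>
    simp only [List.length_cons]
    rw [Fin.sum_univ_succ, List.countP_cons, ih, add_comm]
    by_cases h : p a <;> simp [h]

theorem occ_cons_cons {n : ℕ} (a b : Fin n) (l : List (Fin n)) :
    occ (a :: b :: l) =
      (b :: l).countP (fun c => b < c ∧ c < a) + occ (b :: l) := by
  rw [occ_eq_sum, occ_eq_sum, countP_eq_sum_get]
  simp only [List.length_cons]
  rw [Fin.sum_univ_succ]
  congr 1
  · rw [Fin.sum_univ_succ, Fin.sum_univ_succ]
    simp [Fin.sum_univ_succ, -Finset.sum_boole]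
  · refine Finset.sum_congr rfl fun i _ => ?_
    rw [Fin.sum_univ_succ]
    simp only [Fin.sum_univ_succ (n := l.length + 1)]
    simp

theorem occ_eq_occRec {n : ℕ} (w : List (Fin n)) : occ w = occRec w := by
  induction w with
  | nil => simp [occ_eq_sum, occRec]
  | cons a l ih =>
    cases l with
    | nil => simp [occ_eq_sum, occRec]
    | cons b l => rw [occ_cons_cons, ih, occRec]

/-! ### The cycle form read as a greedy walk -/

theorem nodup_iterate_minimalPeriod {α : Type*} (f : α → α) (a : α) :
    (List.iterate f a (Function.minimalPeriod f a)).Nodup := by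
  rw [← List.range_map_iterate]
  refine List.Nodup.map_on ?_ List.nodup_range
  intro i hi j hj h
  exact Function.iterate_injOn_Iio_minimalPeriod (List.mem_range.mp hi) (List.mem_range.mp hj) h

theorem mem_iterate_minimalPeriod {α : Type*} [Fintype α] (π : Equiv.Perm α) (a b : α) :
    b ∈ List.iterate π a (Function.minimalPeriod π a) ↔ π.SameCycle a b := by
  have hp : 0 < Function.minimalPeriod π a :=
    Function.minimalPeriod_pos_of_mem_periodicPts (π.injective.mem_periodicPts a)
  rw [List.mem_iterate]
  constructor
  · rintro ⟨m, _, rfl⟩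
    exact ⟨m, by simp [Equiv.Perm.iterate_eq_pow]⟩
  · intro h
    obtain ⟨m, -, hm⟩ := h.exists_pow_eq'
    refine ⟨m % Function.minimalPeriod π a, Nat.mod_lt _ hp, ?_⟩
    rw [Function.iterate_mod_minimalPeriod_eq, Equiv.Perm.iterate_eq_pow, hm]

section Cycles

variable {α : Type*} [LinearOrder α]

/-- The greedy walk through all the letters in `S`, starting from the smallest one. -/
def walkAll (π : Equiv.Perm α) (S : Finset α) : List α :=
  if h : S.Nonempty then walk π (S.card - 1) (S.erase (S.min' h)) (S.min' h) else []

theorem walk_of_apply_notMem (π : Equiv.Perm α) (S : Finset α) (a : α) (h : π a ∉ S) :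
    walk π S.card S a = a :: walkAll π S := by
  rcases S.eq_empty_or_nonempty with rfl | hS
  · simp [walk, walkAll]
  · obtain ⟨k, hk⟩ := Nat.exists_eq_succ_of_ne_zero (Finset.card_pos.mpr hS).ne'
    rw [hk, walk, walkAll, dif_pos hS, next, if_neg h, minD, dif_pos hS, hk]
    rfl

/-- As long as the iterates of `a` are distinct and unused the walk follows them; when the next
iterate is not available it restarts at the minimum of what is left. -/
theorem walk_iterate (π : Equiv.Perm α) (S : Finset α) (c : ℕ) (a : α)
    (hnd : (List.iterate π a (c + 1)).Nodup) (hd : ∀ x ∈ List.iterate π a (c + 1), x ∉ S)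
    (hl : π^[c + 1] a ∉ S) :
    walk π (c + S.card) ((List.iterate π (π a) c).toFinset ∪ S) a =
      List.iterate π a (c + 1) ++ walkAll π S := by
  induction c generalizing a with
  | zero => simpa using walk_of_apply_notMem π S a hl
  | succ c ih =>
    have hnd' := hnd
    rw [List.iterate, List.nodup_cons] at hnd'
    have hmem : π a ∈ (List.iterate π (π a) (c + 1)).toFinset ∪ S := by
      simp [List.iterate]
    have hd' : ∀ x ∈ List.iterate π (π a) (c + 1), x ∉ S := fun x hx =>
      hd x (List.mem_cons_of_mem _ hx)
    have herase : ((List.iterate π (π a) (c + 1)).toFinset ∪ S).erase (π a) =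
        (List.iterate π (π (π a)) c).toFinset ∪ S := by
      have h1 := hnd'.2
      rw [List.iterate, List.nodup_cons] at h1
      have h2 : π a ∉ S := hd' _ (by simp [List.iterate])
      rw [List.iterate, List.toFinset_cons, Finset.insert_union, Finset.erase_insert]
      simp [h1.1, h2]
    rw [show c + 1 + S.card = (c + S.card) + 1 by ring, walk, next, if_pos hmem, herase,
      ih (π a) hnd'.2 hd' hl]
    rfl

variable [Fintype α]

theorem card_sameCycle (π : Equiv.Perm α) [DecidableRel π.SameCycle] (a : α) :
    (Finset.univ.filter fun j => π.SameCycle a j).card = Function.minimalPeriod π a := by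
  rw [← List.length_iterate π a (Function.minimalPeriod π a),
    ← List.toFinset_card_of_nodup (nodup_iterate_minimalPeriod π a)]
  congr 1
  ext b
  rw [List.mem_toFinset, mem_iterate_minimalPeriod]
  simp

/-- Induction on the list of cycle minima. As the list increases, its head is the least letter of
all listed cycles, which is where the greedy walk starts; after that cycle is exhausted the walk
restarts on the remaining cycles. -/
theorem flatMap_cycles_eq_walkAll (π : Equiv.Perm α) [DecidableRel π.SameCycle] (L : List α)
    (hs : L.Pairwise (· < ·)) (hmin : ∀ i ∈ L, ∀ j, π.SameCycle i j → i ≤ j)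
    (T : Finset α) (hT : ∀ j, j ∈ T ↔ ∃ i ∈ L, π.SameCycle i j) :
    (L.flatMap fun i => List.iterate π i (Finset.univ.filter fun j => π.SameCycle i j).card) =
      walkAll π T := by
  induction L generalizing T with
  | nil =>
    obtain rfl : T = ∅ := Finset.eq_empty_of_forall_notMem fun j hj => by simpa using (hT j).mp hj
    simp [walkAll]
  | cons m L ih =>
    rw [List.pairwise_cons] at hs
    have hminL : ∀ i ∈ L, ∀ j, π.SameCycle i j → i ≤ j := fun i hi =>
      hmin i (List.mem_cons_of_mem _ hi)
    have hm := hmin m List.mem_cons_self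
    set S := Finset.univ.filter fun j => ∃ i ∈ L, π.SameCycle i j with hS
    rw [List.flatMap_cons, ih hs.2 hminL S (fun j => by simp [hS]), card_sameCycle]
    obtain ⟨c, hc⟩ : ∃ c, Function.minimalPeriod π m = c + 1 :=
      Nat.exists_eq_succ_of_ne_zero (Function.minimalPeriod_pos_of_mem_periodicPts
        (π.injective.mem_periodicPts m)).ne'
    have hmS : ∀ x, π.SameCycle m x → x ∉ S := by
      intro x hx hxS
      obtain ⟨i, hi, hix⟩ := (Finset.mem_filter.mp hxS).2
      exact absurd (hminL i hi m (hix.trans hx.symm)) (not_le.mpr (hs.1 i hi))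
    have hmT : m ∈ T := by simp [hT, Equiv.Perm.SameCycle.refl]
    have hne : T.Nonempty := ⟨m, hmT⟩
    have hminT : T.min' hne = m := by
      refine le_antisymm (T.min'_le m hmT) (T.le_min' hne m fun j hj => ?_)
      obtain ⟨i, hi, hij⟩ := (hT j).mp hj
      rcases List.mem_cons.mp hi with rfl | hi
      · exact hm j hij
      · exact (hs.1 i hi).le.trans (hminL i hi j hij)
    have hnd := nodup_iterate_minimalPeriod π m
    have hmemit := mem_iterate_minimalPeriod π m
    have hper : π^[c + 1] m = m := by rw [← hc]; exact Function.iterate_minimalPeriod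
    rw [hc] at hnd hmemit ⊢
    have hrest : T.erase m = (List.iterate π (π m) c).toFinset ∪ S := by
      have h0 := hnd
      rw [List.iterate, List.nodup_cons] at h0
      ext x
      have hx := hmemit x
      rw [List.iterate, List.mem_cons] at hx
      simp only [hT, hS, Finset.mem_erase, Finset.mem_filter, Finset.mem_univ, true_and,
        List.mem_cons, exists_eq_or_imp, Finset.mem_union, List.mem_toFinset]
      constructor
      · rintro ⟨h1, h2 | h2⟩
        · exact Or.inl ((hx.mpr h2).resolve_left h1)
        · exact Or.inr h2
      · rintro (h1 | h1)
        · exact ⟨fun h => h0.1 (h ▸ h1), Or.inl (hx.mp (Or.inr h1))⟩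
        · refine ⟨?_, Or.inr h1⟩
          rintro rfl
          exact hmS x (Equiv.Perm.SameCycle.refl _ _)
            (Finset.mem_filter.mpr ⟨Finset.mem_univ _, h1⟩)
    have hdisj : Disjoint (List.iterate π (π m) c).toFinset S := by
      rw [Finset.disjoint_left]
      intro x hx
      exact hmS x ((hmemit x).mp (by
        rw [List.iterate]; exact List.mem_cons_of_mem _ (List.mem_toFinset.mp hx)))
    have hcard : T.card - 1 = c + S.card := by
      have h0 := hnd
      rw [List.iterate, List.nodup_cons] at h0
      rw [← Finset.card_erase_of_mem hmT, hrest, Finset.card_union_of_disjoint hdisj,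
        List.toFinset_card_of_nodup h0.2, List.length_iterate]
    rw [walkAll.eq_def π T, dif_pos hne, hminT, hrest, hcard]
    exact (walk_iterate π S c m hnd (fun x hx => hmS x ((hmemit x).mp hx))
      (by rw [hper]; exact hmS m (Equiv.Perm.SameCycle.refl _ _))).symm

end Cycles

theorem flatten_eq_walk {n : ℕ} (π : Equiv.Perm (Fin (n + 1))) :
    flatten π = walk π n (Finset.univ.erase 0) 0 := by
  have h0 : (Finset.univ : Finset (Fin (n + 1))).min' Finset.univ_nonempty = 0 :=
    le_antisymm (Finset.min'_le _ _ (Finset.mem_univ _)) (Fin.zero_le _)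
  rw [flatten, flatMap_cycles_eq_walkAll (T := Finset.univ), walkAll,
    dif_pos Finset.univ_nonempty, h0]
  · simp
  · exact (List.pairwise_lt_finRange _).filter _
  · intro i hi
    simpa using hi
  · refine fun j => iff_of_true (Finset.mem_univ _) ?_
    set C := Finset.univ.filter fun i => π.SameCycle j i with hC
    have hne : C.Nonempty := ⟨j, by simp [hC, Equiv.Perm.SameCycle.refl]⟩
    have h1 : π.SameCycle j (C.min' hne) := (Finset.mem_filter.mp (C.min'_mem hne)).2
    refine ⟨C.min' hne, ?_, h1.symm⟩
    simp only [List.mem_filter, List.mem_finRange, decide_eq_true_eq, true_and]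
    exact fun i hi => C.min'_le i (Finset.mem_filter.mpr ⟨Finset.mem_univ _, h1.trans hi⟩)

theorem sum_pow_occ_flatten {R : Type*} [CommRing R] (q : R) (n : ℕ) :
    ∑ π : Equiv.Perm (Fin (n + 1)), q ^ occ (flatten π) = rankSum q n 0 := by
  have h := walkSum_eq_rankSum q n (Finset.univ.erase (0 : Fin (n + 1))) 0 (by simp) (by simp)
  have h0 : rankIn (Finset.univ.erase (0 : Fin (n + 1))) 0 = 0 := by
    simp [rankIn]
  have h1 : permsOn (insert (0 : Fin (n + 1)) (Finset.univ.erase (0 : Fin (n + 1)))) = Finset.univ := by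
    ext π; simp [mem_permsOn]
  rw [h0, walkSum, h1] at h
  rw [← h]
  refine Finset.sum_congr rfl fun π _ => ?_
  rw [occ_eq_occRec, flatten_eq_walk]

theorem coeff_rankSum_X (n r : ℕ) :
    coeff r (rankSum (X : ℚ⟦X⟧⟦X⟧) n 0) = (count (n + 1) r : ℚ⟦X⟧) := by
  rw [← sum_pow_occ_flatten, map_sum, count, Finset.card_filter, Nat.cast_sum]
  refine Finset.sum_congr rfl fun π _ => ?_
  rw [coeff_X_pow]
  simp [eq_comm]

/-! ### The functional equation and the kernel method -/

section Kernel

variable {R : Type*} [CommRing R]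

/-- The generating polynomial of flattened words with `k + 1` letters besides the leading one,
by the rank `b` of their first letter. -/
def firstSum (q : R) (k b : ℕ) : R := (if b = 0 then 2 else 1) * rankSum q k b

/-- The generating polynomial in which a first letter of rank `b` contributes `q ^ (k - b)`. -/
def topSum (q : R) (k : ℕ) : R := ∑ b ∈ Finset.range (k + 1), q ^ (k - b) * firstSum q k b

/-- The generating polynomial in which a first letter of rank `b` contributes `v ^ b`. -/
def firstPoly (q v : R) (k : ℕ) : R := ∑ b ∈ Finset.range (k + 1), firstSum q k b * v ^ b

theorem rankSum_succ (q : R) (k i : ℕ) : rankSum q (k + 1) i =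
    ∑ b ∈ Finset.range (k + 1), (if b < i then q ^ (i - 1 - b) else 1) * firstSum q k b := rfl

theorem rankSum_succ_zero (q : R) (k : ℕ) : rankSum q (k + 1) 0 =
    ∑ b ∈ Finset.range (k + 1), firstSum q k b := by
  simp [rankSum_succ]

theorem firstSum_zero (q : R) (k : ℕ) : firstSum q k 0 = 2 * rankSum q k 0 := by simp [firstSum]

theorem firstSum_succ (q : R) (k b : ℕ) : firstSum q k (b + 1) = rankSum q k (b + 1) := by
  simp [firstSum]

/-- Two geometric sums, split at `i = b`, with both denominators cleared so that the identity holds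
in any commutative ring. -/
theorem kernel_sum (q v : R) (b m : ℕ) :
    (v - 1) * (1 - q * v) * ∑ i ∈ Finset.range (b + m + 2),
        (if b < i then q ^ (i - 1 - b) else 1) * v ^ i =
      (1 - q * v) * (v ^ (b + 1) - 1) + (v - 1) * v ^ (b + 1) * (1 - (q * v) ^ (m + 1)) := by
  have h1 : ∑ i ∈ Finset.range (b + 1), (if b < i then q ^ (i - 1 - b) else 1) * v ^ i =
      ∑ i ∈ Finset.range (b + 1), v ^ i := by
    refine Finset.sum_congr rfl fun i hi => ?_
    rw [if_neg (by have := Finset.mem_range.mp hi; omega), one_mul]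
  have h2 : ∑ i ∈ Finset.range (m + 1),
        (if b < b + 1 + i then q ^ (b + 1 + i - 1 - b) else 1) * v ^ (b + 1 + i) =
      v ^ (b + 1) * ∑ i ∈ Finset.range (m + 1), (q * v) ^ i := by
    rw [Finset.mul_sum]
    refine Finset.sum_congr rfl fun i _ => ?_
    rw [if_pos (by omega), show b + 1 + i - 1 - b = i by omega, pow_add, mul_pow]
    ring
  rw [show b + m + 2 = (b + 1) + (m + 1) by ring, Finset.sum_range_add, h1, h2]
  have h3 := mul_geom_sum v (b + 1)
  have h4 := mul_neg_geom_sum (q * v) (m + 1)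
  linear_combination (1 - q * v) * h3 + (v - 1) * v ^ (b + 1) * h4

/-- Insert the recursion for `rankSum` and sum over the rank `i` first. The upper end of the
geometric sum in `q * v` produces the boundary term `topSum`; the doubled weight at rank 0 accounts
for `v - 2` in place of `v - 1`. -/
theorem kernel_firstPoly (q v : R) (k : ℕ) :
    (v - 1) * (1 - q * v) * firstPoly q v (k + 1) = (1 - q) * v ^ 2 * firstPoly q v k +
      (1 - q * v) * (v - 2) * rankSum q (k + 1) 0 -
      q * v * (v - 1) * (v ^ (k + 1) * topSum q k) := by
  have h1 : firstPoly q v (k + 1) = rankSum q (k + 1) 0 +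
      ∑ i ∈ Finset.range (k + 2), rankSum q (k + 1) i * v ^ i := by
    rw [firstPoly, Finset.sum_range_succ', Finset.sum_range_succ' _ (k + 1)]
    simp only [firstSum_succ, firstSum_zero]
    ring
  have h2 : ∑ i ∈ Finset.range (k + 2), rankSum q (k + 1) i * v ^ i =
      ∑ b ∈ Finset.range (k + 1), firstSum q k b * ∑ i ∈ Finset.range (k + 2),
        (if b < i then q ^ (i - 1 - b) else 1) * v ^ i := by
    simp only [rankSum_succ, Finset.sum_mul, Finset.mul_sum]
    rw [Finset.sum_comm]
    refine Finset.sum_congr rfl fun b _ => Finset.sum_congr rfl fun i _ => ?_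
    ring
  rw [h1, h2, rankSum_succ_zero, firstPoly, topSum]
  simp only [mul_add, Finset.mul_sum, ← Finset.sum_add_distrib, ← Finset.sum_sub_distrib]
  refine Finset.sum_congr rfl fun b hb => ?_
  obtain ⟨m, rfl⟩ := Nat.exists_eq_add_of_le (Nat.lt_succ_iff.mp (Finset.mem_range.mp hb))
  have h3 := kernel_sum q v b m
  rw [Finset.mul_sum] at h3
  rw [← Finset.mul_sum, ← Finset.mul_sum, show b + m - b = m by omega]
  rw [← Finset.mul_sum] at h3
  linear_combination firstSum q (b + m) b * h3

theorem rankSum_last (q : R) (k : ℕ) : rankSum q (k + 1) (k + 1) = topSum q k := by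
  rw [rankSum_succ, topSum]
  refine Finset.sum_congr rfl fun b hb => ?_
  rw [if_pos (Finset.mem_range.mp hb)]
  rfl

/-- Multiplication by `q` turns the exponents `k - 1 - b` into those of `topSum`, so only the term
`b = k` needs correction. The next lemma does the same with `q ^ 2` and two corrected terms. -/
theorem mul_rankSum_last_sub_one (q : R) (k : ℕ) :
    q * rankSum q (k + 1) k = topSum q k + (q - 1) * firstSum q k k := by
  rw [rankSum_succ, topSum, Finset.sum_range_succ, Finset.sum_range_succ, mul_add,
    Finset.mul_sum]
  have : ∑ b ∈ Finset.range k, q * ((if b < k then q ^ (k - 1 - b) else 1) * firstSum q k b) =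
      ∑ b ∈ Finset.range k, q ^ (k - b) * firstSum q k b := by
    refine Finset.sum_congr rfl fun b hb => ?_
    have hb := Finset.mem_range.mp hb
    rw [if_pos hb, show k - b = (k - 1 - b) + 1 by omega, pow_succ]
    ring
  rw [this]
  simp
  ring

theorem sq_mul_rankSum_last_sub_two (q : R) (k : ℕ) :
    q ^ 2 * rankSum q (k + 2) k = topSum q (k + 1) + (q ^ 2 - 1) * firstSum q (k + 1) (k + 1) +
      (q ^ 2 - q) * firstSum q (k + 1) k := by
  rw [rankSum_succ, topSum, Finset.sum_range_succ, Finset.sum_range_succ,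
    Finset.sum_range_succ _ (k + 1), Finset.sum_range_succ _ k, mul_add, mul_add,
    Finset.mul_sum]
  have : ∑ b ∈ Finset.range k,
        q ^ 2 * ((if b < k then q ^ (k - 1 - b) else 1) * firstSum q (k + 1) b) =
      ∑ b ∈ Finset.range k, q ^ (k + 1 - b) * firstSum q (k + 1) b := by
    refine Finset.sum_congr rfl fun b hb => ?_
    have hb := Finset.mem_range.mp hb
    rw [if_pos hb, show k + 1 - b = (k - 1 - b) + 2 by omega, pow_add]
    ring
  rw [this]
  simp
  ring

/-- After multiplication by `q`, only the three highest ranks survive modulo `q ^ 4`. Their powers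
of `q` are just what the preceding lemmas need to express these terms through earlier values of
`topSum`. -/
theorem topSum_rec {q : R} (hq : q ^ 4 = 0) (k : ℕ) :
    q * topSum q (k + 3) = q * (3 * topSum q (k + 2) - (3 - 2 * q - q ^ 2) * topSum q (k + 1) +
      (1 - q) ^ 2 * topSum q k) := by
  have h0 : topSum q (k + 3) = firstSum q (k + 3) (k + 3) + q * firstSum q (k + 3) (k + 2) +
      q ^ 2 * firstSum q (k + 3) (k + 1) +
      q ^ 3 * ∑ b ∈ Finset.range (k + 1), q ^ (k - b) * firstSum q (k + 3) b := by
    rw [topSum, Finset.sum_range_succ, Finset.sum_range_succ, Finset.sum_range_succ,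
      Finset.mul_sum]
    have : ∑ b ∈ Finset.range (k + 1), q ^ (k + 3 - b) * firstSum q (k + 3) b =
        ∑ b ∈ Finset.range (k + 1), q ^ 3 * (q ^ (k - b) * firstSum q (k + 3) b) := by
      refine Finset.sum_congr rfl fun b hb => ?_
      have hb := Finset.mem_range.mp hb
      rw [show k + 3 - b = 3 + (k - b) by omega, pow_add]
      ring
    rw [this, show k + 3 - (k + 3) = 0 by omega, show k + 3 - (k + 2) = 1 by omega,
      show k + 3 - (k + 1) = 2 by omega]
    ring
  have h1 := rankSum_last q (k + 2)
  have h2 := mul_rankSum_last_sub_one q (k + 2)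
  have h3 := sq_mul_rankSum_last_sub_two q (k + 1)
  have h4 := rankSum_last q (k + 1)
  have h5 := mul_rankSum_last_sub_one q (k + 1)
  have h6 := rankSum_last q k
  simp only [firstSum_succ] at h0 h2 h3 h5
  simp only [add_assoc, Nat.reduceAdd] at h0 h1 h2 h3 h4 h5 h6
  linear_combination q * h0 + q * h1 + q * h2 + q * h3 + q * (q ^ 2 + q - 2) * h4 +
    q * (q - 1) * h5 + q * (q - 1) ^ 2 * h6 +
    (∑ b ∈ Finset.range (k + 1), q ^ (k - b) * firstSum q (k + 3) b) * hq

theorem topSum_zero (q : R) : topSum q 0 = 2 := by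
  simp [topSum, firstSum, rankSum]

theorem topSum_one (q : R) : topSum q 1 = 2 + 4 * q := by
  simp [topSum, firstSum, rankSum, Finset.sum_range_succ]
  ring

theorem topSum_two (q : R) : topSum q 2 = 2 + 10 * q + 12 * q ^ 2 := by
  simp [topSum, firstSum, rankSum, Finset.sum_range_succ]
  ring

theorem sum_topSum {q z : R} (hq : q ^ 4 = 0) (N : ℕ) (hz : z ^ (N + 4) = 0) :
    q * ((1 - 3 * z + (3 - 2 * q - q ^ 2) * z ^ 2 - (1 - q) ^ 2 * z ^ 3) *
        ∑ k ∈ Finset.range (N + 3), z ^ (k + 1) * topSum q k) =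
      q * (2 * z + (4 * q - 4) * z ^ 2 + (2 - 6 * q + 10 * q ^ 2) * z ^ 3) := by
  -- The recurrence cancels all middle coefficients; the error of truncation is kept explicitly and
  -- is divisible by `z ^ (N + 4)`.
  have h : ∀ N : ℕ, q * ((1 - 3 * z + (3 - 2 * q - q ^ 2) * z ^ 2 - (1 - q) ^ 2 * z ^ 3) *
        ∑ k ∈ Finset.range (N + 3), z ^ (k + 1) * topSum q k) =
      q * (2 * z + (4 * q - 4) * z ^ 2 + (2 - 6 * q + 10 * q ^ 2) * z ^ 3) +
      q * z ^ (N + 4) * (-3 * topSum q (N + 2) + (3 - 2 * q - q ^ 2) * topSum q (N + 1) -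
        (1 - q) ^ 2 * topSum q N + z * ((3 - 2 * q - q ^ 2) * topSum q (N + 2) -
        (1 - q) ^ 2 * topSum q (N + 1)) - z ^ 2 * (1 - q) ^ 2 * topSum q (N + 2)) := by
    intro N
    induction N with
    | zero =>
      simp only [Finset.sum_range_succ, Finset.sum_range_zero, zero_add, topSum_zero, topSum_one,
        topSum_two]
      ring
    | succ N ih =>
      have h1 := topSum_rec hq N
      rw [show N + 1 + 3 = N + 3 + 1 by ring, Finset.sum_range_succ, mul_add, mul_add, ih,
        show N + 1 + 2 = N + 3 by ring, show N + 1 + 1 = N + 2 by ring]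
      linear_combination z ^ (N + 4) * h1
  rw [h N, hz]
  ring

/-- On the kernel curve the `firstPoly` terms for consecutive `k`, weighted by powers of `x`, cancel
in pairs, and only the last one remains. -/
theorem telescoped_kernel {q x v : R} (hv : (v - 1) * (1 - q * v) = x * (1 - q) * v ^ 2) (M : ℕ) :
    (v - 1) * (1 - q * v) * (x ^ (M + 1) * firstPoly q v M) =
      x * (2 * ((v - 1) * (1 - q * v)) +
        (1 - q * v) * (v - 2) * ∑ k ∈ Finset.range M, x ^ (k + 1) * rankSum q (k + 1) 0 -
        q * v * (v - 1) * ∑ k ∈ Finset.range M, (x * v) ^ (k + 1) * topSum q k) := by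
  induction M with
  | zero =>
    have : firstPoly q v 0 = 2 := by simp [firstPoly, firstSum, rankSum]
    rw [this]
    simp
    ring
  | succ M ih =>
    rw [Finset.sum_range_succ, Finset.sum_range_succ, mul_pow x v (M + 1)]
    linear_combination ih + x ^ (M + 2) * kernel_firstPoly q v M -
      x ^ (M + 1) * firstPoly q v M * hv

/-- The denominator coming from `topSum`, made homogeneous with respect to `w`. -/
def denom (q x w : R) : R :=
  w ^ 3 - 3 * x * w ^ 2 + (3 - 2 * q - q ^ 2) * x ^ 2 * w - (1 - q) ^ 2 * x ^ 3

/-- The numerator coming from `topSum`, made homogeneous with respect to `w`. -/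
def numer (q x w : R) : R :=
  2 * x * w ^ 2 + (4 * q - 4) * x ^ 2 * w + (2 - 6 * q + 10 * q ^ 2) * x ^ 3

/-- Nilpotency of `x` kills the last `firstPoly` term, so all sums are finite and no convergence is
needed. The price is the factor `x` on both sides, which cannot be cancelled here. Eliminating the
sum of the `topSum` terms by `sum_topSum` leaves one linear equation for the wanted sum. -/
theorem kernel_method {q x v w : R} (hq : q ^ 4 = 0) (N : ℕ) (hx : x ^ (N + 4) = 0)
    (hvw : w * v = 1) (hw : (1 - w) * (w - q) = x * (1 - q)) :
    x * ((2 * w - 1) * (w - q) * denom q x w *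
        ∑ k ∈ Finset.range (N + 3), x ^ (k + 1) * rankSum q (k + 1) 0) =
      x * (2 * x * (1 - q) * denom q x w - q * (1 - w) * numer q x w) := by
  have hv : (v - 1) * (1 - q * v) = x * (1 - q) * v ^ 2 := by
    linear_combination v ^ 2 * hw + (-(1 + q) * v + w * v + 1) * hvw
  have h1 := telescoped_kernel hv (N + 3)
  rw [hx] at h1
  set A := ∑ k ∈ Finset.range (N + 3), x ^ (k + 1) * rankSum q (k + 1) 0
  have h2 := sum_topSum hq N (z := x * v) (by rw [mul_pow, hx, zero_mul])
  set E := ∑ k ∈ Finset.range (N + 3), (x * v) ^ (k + 1) * topSum q k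
  have hden : w ^ 3 * (1 - 3 * (x * v) + (3 - 2 * q - q ^ 2) * (x * v) ^ 2 -
      (1 - q) ^ 2 * (x * v) ^ 3) = denom q x w := by
    have e1 : w ^ 3 * v = w ^ 2 := by linear_combination w ^ 2 * hvw
    have e2 : w ^ 3 * v ^ 2 = w := by linear_combination (w ^ 2 * v + w) * hvw
    have e3 : w ^ 3 * v ^ 3 = 1 := by linear_combination (w ^ 2 * v ^ 2 + w * v + 1) * hvw
    rw [denom]
    linear_combination -3 * x * e1 + (3 - 2 * q - q ^ 2) * x ^ 2 * e2 - (1 - q) ^ 2 * x ^ 3 * e3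
  have hnum : w ^ 3 * (2 * (x * v) + (4 * q - 4) * (x * v) ^ 2 +
      (2 - 6 * q + 10 * q ^ 2) * (x * v) ^ 3) = numer q x w := by
    have e1 : w ^ 3 * v = w ^ 2 := by linear_combination w ^ 2 * hvw
    have e2 : w ^ 3 * v ^ 2 = w := by linear_combination (w ^ 2 * v + w) * hvw
    have e3 : w ^ 3 * v ^ 3 = 1 := by linear_combination (w ^ 2 * v ^ 2 + w * v + 1) * hvw
    rw [numer]
    linear_combination 2 * x * e1 + (4 * q - 4) * x ^ 2 * e2 +
      (2 - 6 * q + 10 * q ^ 2) * x ^ 3 * e3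
  have h3 : q * (denom q x w * E) = q * numer q x w := by
    rw [← hden, ← hnum]
    linear_combination w ^ 3 * h2
  have f1 : w ^ 2 * ((v - 1) * (1 - q * v)) = (1 - w) * (w - q) := by
    linear_combination (w * (1 + q) - q * (w * v + 1)) * hvw
  have f2 : w ^ 2 * ((1 - q * v) * (v - 2)) = (w - q) * (1 - 2 * w) := by
    linear_combination (w * (1 + 2 * q) - q * (w * v + 1)) * hvw
  have f3 : w ^ 2 * (q * v * (v - 1)) = q * (1 - w) := by
    linear_combination (q * (w * v + 1) - q * w) * hvw
  have h4 : x * (2 * ((1 - w) * (w - q)) + (w - q) * (1 - 2 * w) * A - q * (1 - w) * E) = 0 := by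
    linear_combination -2 * x * f1 - x * A * f2 + x * E * f3 - w ^ 2 * h1
  linear_combination -denom q x w * h4 - x * (1 - w) * h3 + 2 * x * denom q x w * hw

end Kernel

/-! ### Solving for the coefficients of `q ^ 0, …, q ^ 3` -/

section Coefficients

variable {K : Type*} [Field K]

/-- The first four coefficients of `f` are `a₀`, `a₁`, `a₂`, `a₃`. -/
def HasCoeffs (f : K⟦X⟧) (a₀ a₁ a₂ a₃ : K) : Prop :=
  coeff 0 f = a₀ ∧ coeff 1 f = a₁ ∧ coeff 2 f = a₂ ∧ coeff 3 f = a₃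

namespace HasCoeffs

variable {f g : K⟦X⟧} {a₀ a₁ a₂ a₃ b₀ b₁ b₂ b₃ : K}

theorem congr (hf : HasCoeffs f a₀ a₁ a₂ a₃) (h₀ : a₀ = b₀) (h₁ : a₁ = b₁) (h₂ : a₂ = b₂)
    (h₃ : a₃ = b₃) : HasCoeffs f b₀ b₁ b₂ b₃ := by
  subst h₀ h₁ h₂ h₃; exact hf

theorem add (hf : HasCoeffs f a₀ a₁ a₂ a₃) (hg : HasCoeffs g b₀ b₁ b₂ b₃) :
    HasCoeffs (f + g) (a₀ + b₀) (a₁ + b₁) (a₂ + b₂) (a₃ + b₃) := by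
  obtain ⟨rfl, rfl, rfl, rfl⟩ := hf
  obtain ⟨rfl, rfl, rfl, rfl⟩ := hg
  exact ⟨map_add _ _ _, map_add _ _ _, map_add _ _ _, map_add _ _ _⟩

theorem sub (hf : HasCoeffs f a₀ a₁ a₂ a₃) (hg : HasCoeffs g b₀ b₁ b₂ b₃) :
    HasCoeffs (f - g) (a₀ - b₀) (a₁ - b₁) (a₂ - b₂) (a₃ - b₃) := by
  obtain ⟨rfl, rfl, rfl, rfl⟩ := hf
  obtain ⟨rfl, rfl, rfl, rfl⟩ := hg
  exact ⟨map_sub _ _ _, map_sub _ _ _, map_sub _ _ _, map_sub _ _ _⟩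

theorem mul (hf : HasCoeffs f a₀ a₁ a₂ a₃) (hg : HasCoeffs g b₀ b₁ b₂ b₃) :
    HasCoeffs (f * g) (a₀ * b₀) (a₀ * b₁ + a₁ * b₀) (a₀ * b₂ + a₁ * b₁ + a₂ * b₀)
      (a₀ * b₃ + a₁ * b₂ + a₂ * b₁ + a₃ * b₀) := by
  obtain ⟨rfl, rfl, rfl, rfl⟩ := hf
  obtain ⟨rfl, rfl, rfl, rfl⟩ := hg
  refine ⟨?_, ?_, ?_, ?_⟩ <;>
    simp [coeff_mul, Finset.Nat.antidiagonal_succ] <;> ring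

theorem const (a : K) : HasCoeffs (C a) a 0 0 0 := by
  refine ⟨?_, ?_, ?_, ?_⟩ <;> simp [coeff_C]

theorem one : HasCoeffs (1 : K⟦X⟧) 1 0 0 0 := by
  simpa using const (1 : K)

theorem ofNat (n : ℕ) [n.AtLeastTwo] :
    HasCoeffs (OfNat.ofNat n : K⟦X⟧) (OfNat.ofNat n) 0 0 0 := by
  have h := const (OfNat.ofNat n : K)
  rwa [map_ofNat] at h

theorem variable_X : HasCoeffs (X : K⟦X⟧) 0 1 0 0 := by
  refine ⟨?_, ?_, ?_, ?_⟩ <;> simp [coeff_X]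

/-- Division of power series truncated at order four: the triangular system is solved one
coefficient at a time, since `a₀ ≠ 0`. -/
theorem eq_of_mul_eq {A B G : K⟦X⟧} {c₀ c₁ c₂ c₃ : K} (hA : HasCoeffs A a₀ a₁ a₂ a₃)
    (hB : HasCoeffs B b₀ b₁ b₂ b₃) (h : ∀ d < 4, coeff d (A * G) = coeff d B) (ha : a₀ ≠ 0)
    (h₀ : a₀ * c₀ = b₀) (h₁ : a₀ * c₁ + a₁ * c₀ = b₁) (h₂ : a₀ * c₂ + a₁ * c₁ + a₂ * c₀ = b₂)
    (h₃ : a₀ * c₃ + a₁ * c₂ + a₂ * c₁ + a₃ * c₀ = b₃) : HasCoeffs G c₀ c₁ c₂ c₃ := by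
  obtain ⟨e0, e1, e2, e3⟩ := hA.mul (⟨rfl, rfl, rfl, rfl⟩ : HasCoeffs G _ _ _ _)
  obtain ⟨f0, f1, f2, f3⟩ := hB
  rw [h 0 (by norm_num), f0] at e0
  rw [h 1 (by norm_num), f1] at e1
  rw [h 2 (by norm_num), f2] at e2
  rw [h 3 (by norm_num), f3] at e3
  have g0 : coeff 0 G = c₀ := mul_left_cancel₀ ha (by linear_combination -h₀ - e0)
  rw [g0] at e1 e2 e3
  have g1 : coeff 1 G = c₁ := mul_left_cancel₀ ha (by linear_combination -h₁ - e1)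
  rw [g1] at e2 e3
  have g2 : coeff 2 G = c₂ := mul_left_cancel₀ ha (by linear_combination -h₂ - e2)
  rw [g2] at e3
  exact ⟨g0, g1, g2, mul_left_cancel₀ ha (by linear_combination -h₃ - e3)⟩

end HasCoeffs

-- The variable of the power series plays the role of `q`. At `q = 0` one has `w = (1 + s) / 2` and
-- `x = w * (1 - w)`, so `denom` becomes `(w - x) ^ 3 = w ^ 6` and the factor of `G` has constant
-- term `s * w ^ 7 ≠ 0`; hence the equation determines the four coefficients.
set_option maxHeartbeats 4000000 in
theorem hasCoeffs_of_kernel [CharZero K] {s x : K} (hs : s ≠ 0) (hs1 : 1 + s ≠ 0)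
    (hx : x = (1 - s ^ 2) / 4) {w G : K⟦X⟧}
    (hw : HasCoeffs w
      ((1 + s) / 2)
      ((-1 + 2 * s - s ^ 2) / (4 * s))
      ((-1 + 2 * s ^ 2 - s ^ 4) / (16 * s ^ 3))
      ((-1 + s ^ 2 + s ^ 4 - s ^ 6) / (32 * s ^ 5)))
    (h : ∀ d < 4, coeff d ((2 * w - 1) * (w - X) * denom X (C x) w * G) =
      coeff d (2 * C x * (1 - X) * denom X (C x) w - X * (1 - w) * numer X (C x) w)) :
    HasCoeffs G
      ((1 - s) / s)
      ((1 - 6 * s ^ 2 + 8 * s ^ 3 - 3 * s ^ 4) / (2 * s ^ 3 * (1 + s) ^ 2))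
      ((3 - 2 * s - 11 * s ^ 2 + 4 * s ^ 3 + 29 * s ^ 4 - 34 * s ^ 5 + 11 * s ^ 6) /
        (8 * s ^ 5 * (1 + s) ^ 2))
      ((5 - s - 18 * s ^ 2 + 2 * s ^ 3 + 40 * s ^ 5 + 66 * s ^ 6 - 242 * s ^ 7 + 203 * s ^ 8 -
        55 * s ^ 9) / (16 * s ^ 7 * (1 + s) ^ 3)) := by
  subst hx
  have hx := HasCoeffs.const ((1 - s ^ 2) / 4)
  have hX := HasCoeffs.variable_X (K := K)
  have h1 := HasCoeffs.one (K := K)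
  have h2 := HasCoeffs.ofNat (K := K) 2
  have h3 := HasCoeffs.ofNat (K := K) 3
  have h4 := HasCoeffs.ofNat (K := K) 4
  have h6 := HasCoeffs.ofNat (K := K) 6
  have h10 := HasCoeffs.ofNat (K := K) 10
  have hP : HasCoeffs ((2 * w - 1) * (w - X))
      ((s + s ^ 2) / 2)
      ((-1 - s ^ 2 - 2 * s ^ 3) / (4 * s))
      ((-1 + 2 * s ^ 2 - s ^ 4) / (16 * s ^ 3))
      ((-1 + s ^ 2 + s ^ 4 - s ^ 6) / (32 * s ^ 5)) := by
    refine (((h2.mul hw).sub h1).mul (hw.sub hX)).congr ?_ ?_ ?_ ?_ <;> field_simp <;> ring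
  have hww : HasCoeffs (w ^ 2)
      ((1 + 2 * s + s ^ 2) / 4)
      ((-1 + s + s ^ 2 - s ^ 3) / (4 * s))
      ((-1 - 2 * s ^ 2 + 8 * s ^ 3 - 5 * s ^ 4) / (16 * s ^ 3))
      ((-1 - s ^ 2 + 5 * s ^ 4 - 3 * s ^ 6) / (32 * s ^ 5)) := by
    refine ((pow_two w).symm ▸ hw.mul hw).congr ?_ ?_ ?_ ?_ <;> field_simp <;> ring
  have hwww : HasCoeffs (w ^ 3)
      ((1 + 3 * s + 3 * s ^ 2 + s ^ 3) / 8)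
      ((-3 + 6 * s ^ 2 - 3 * s ^ 4) / (16 * s))
      ((-3 - 15 * s ^ 2 + 24 * s ^ 3 + 15 * s ^ 4 - 24 * s ^ 5 + 3 * s ^ 6) / (64 * s ^ 3))
      ((-3 - 8 * s ^ 2 - 6 * s ^ 4 + 64 * s ^ 5 - 48 * s ^ 6 + s ^ 8) / (128 * s ^ 5)) := by
    refine ((pow_succ w 2).symm ▸ hww.mul hw).congr ?_ ?_ ?_ ?_ <;> field_simp <;> ring
  have hxx : HasCoeffs ((C ((1 - s ^ 2) / 4) : K⟦X⟧) ^ 2)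
      ((1 - 2 * s ^ 2 + s ^ 4) / 16)
      (0)
      (0)
      (0) := by
    refine ((pow_two (C ((1 - s ^ 2) / 4) : K⟦X⟧)).symm ▸ hx.mul hx).congr ?_ ?_ ?_ ?_ <;> field_simp <;> ring
  have hxxx : HasCoeffs ((C ((1 - s ^ 2) / 4) : K⟦X⟧) ^ 3)
      ((1 - 3 * s ^ 2 + 3 * s ^ 4 - s ^ 6) / 64)
      (0)
      (0)
      (0) := by
    refine ((pow_succ (C ((1 - s ^ 2) / 4) : K⟦X⟧) 2).symm ▸ hxx.mul hx).congr ?_ ?_ ?_ ?_ <;> field_simp <;> ring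
  have hXX : HasCoeffs ((X : K⟦X⟧) ^ 2)
      (0)
      (0)
      ((1))
      (0) := by
    refine ((pow_two (X : K⟦X⟧)).symm ▸ hX.mul hX).congr ?_ ?_ ?_ ?_ <;> field_simp <;> ring
  have hq : HasCoeffs ((1 - (X : K⟦X⟧)) ^ 2)
      ((1))
      ((-2))
      ((1))
      (0) := by
    refine ((pow_two (1 - (X : K⟦X⟧))).symm ▸ (h1.sub hX).mul (h1.sub hX)).congr ?_ ?_ ?_ ?_ <;> field_simp <;> ring
  have hD : HasCoeffs (denom X (C ((1 - s ^ 2) / 4) : K⟦X⟧) w)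
      ((1 + 6 * s + 15 * s ^ 2 + 20 * s ^ 3 + 15 * s ^ 4 + 6 * s ^ 5 + s ^ 6) / 64)
      ((-3 - 8 * s - s ^ 2 + 14 * s ^ 3 + 11 * s ^ 4 - 4 * s ^ 5 - 7 * s ^ 6 - 2 * s ^ 7) / (64 * s))
      ((-3 - 28 * s ^ 2 - 28 * s ^ 3 + 62 * s ^ 4 + 60 * s ^ 5 - 28 * s ^ 6 - 36 * s ^ 7 - 3 * s ^ 8 + 4 * s ^ 9) / (256 * s ^ 3))
      ((-3 - 19 * s ^ 2 - 110 * s ^ 4 + 240 * s ^ 5 - 86 * s ^ 6 + 32 * s ^ 7 - 47 * s ^ 8 - 16 * s ^ 9 + 9 * s ^ 10) / (512 * s ^ 5)) := by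
    refine (((hwww.sub ((h3.mul hx).mul hww)).add ((((h3.sub (h2.mul hX)).sub hXX).mul hxx).mul hw)).sub
      (hq.mul hxxx)).congr ?_ ?_ ?_ ?_ <;> field_simp <;> ring
  have hN : HasCoeffs (numer X (C ((1 - s ^ 2) / 4) : K⟦X⟧) w)
      ((1 + 4 * s + 5 * s ^ 2 - 5 * s ^ 4 - 4 * s ^ 5 - s ^ 6) / 32)
      ((-2 + s + 10 * s ^ 2 + s ^ 3 - 14 * s ^ 4 - 5 * s ^ 5 + 6 * s ^ 6 + 3 * s ^ 7) / (32 * s))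
      ((-1 - 10 * s ^ 2 + 34 * s ^ 3 + 4 * s ^ 4 - 62 * s ^ 5 + 10 * s ^ 6 + 38 * s ^ 7 - 3 * s ^ 8 - 10 * s ^ 9) / (64 * s ^ 3))
      ((-1 - 5 * s ^ 2 + 22 * s ^ 4 - 26 * s ^ 6 + 11 * s ^ 8 - s ^ 10) / (128 * s ^ 5)) := by
    refine ((((h2.mul hx).mul hww).add ((((h4.mul hX).sub h4).mul hxx).mul hw)).add
      (((h2.sub (h6.mul hX)).add (h10.mul hXX)).mul hxxx)).congr ?_ ?_ ?_ ?_ <;> field_simp <;> ring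
  have hA : HasCoeffs ((2 * w - 1) * (w - X) * denom X (C ((1 - s ^ 2) / 4) : K⟦X⟧) w)
      ((s + 7 * s ^ 2 + 21 * s ^ 3 + 35 * s ^ 4 + 35 * s ^ 5 + 21 * s ^ 6 + 7 * s ^ 7 + s ^ 8) / 128)
      ((-1 - 12 * s - 38 * s ^ 2 - 46 * s ^ 3 - 16 * s ^ 4 - 6 * s ^ 5 - 42 * s ^ 6 - 58 * s ^ 7 - 31 * s ^ 8 - 6 * s ^ 9) / (256 * s))
      ((-1 + 13 * s ^ 2 - 48 * s ^ 3 - 98 * s ^ 4 + 120 * s ^ 5 + 226 * s ^ 6 - 72 * s ^ 7 - 205 * s ^ 8 - 24 * s ^ 9 + 65 * s ^ 10 + 24 * s ^ 11) / (1024 * s ^ 3))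
      ((-1 - 4 * s ^ 2 - 29 * s ^ 4 - 288 * s ^ 5 + 416 * s ^ 6 + 432 * s ^ 7 - 443 * s ^ 8 - 272 * s ^ 9 + 36 * s ^ 10 + 144 * s ^ 11 + 25 * s ^ 12 - 16 * s ^ 13) / (2048 * s ^ 5)) := by
    refine (hP.mul hD).congr ?_ ?_ ?_ ?_ <;> field_simp <;> ring
  have hM : HasCoeffs ((1 - w) * numer X (C ((1 - s ^ 2) / 4) : K⟦X⟧) w)
      ((1 + 3 * s + s ^ 2 - 5 * s ^ 3 - 5 * s ^ 4 + s ^ 5 + 3 * s ^ 6 + s ^ 7) / 64)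
      ((-3 + 8 * s + 16 * s ^ 2 - 24 * s ^ 3 - 30 * s ^ 4 + 24 * s ^ 5 + 24 * s ^ 6 - 8 * s ^ 7 - 7 * s ^ 8) / (128 * s))
      ((-3 - 17 * s ^ 2 + 192 * s ^ 3 - 206 * s ^ 4 - 288 * s ^ 5 + 398 * s ^ 6 + 128 * s ^ 7 - 223 * s ^ 8 - 32 * s ^ 9 + 51 * s ^ 10) / (512 * s ^ 3))
      ((-3 - 6 * s ^ 2 + 291 * s ^ 4 - 464 * s ^ 5 - 260 * s ^ 6 + 752 * s ^ 7 - 93 * s ^ 8 - 368 * s ^ 9 + 106 * s ^ 10 + 80 * s ^ 11 - 35 * s ^ 12) / (1024 * s ^ 5)) := by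
    refine ((h1.sub hw).mul hN).congr ?_ ?_ ?_ ?_ <;> field_simp <;> ring
  have hB : HasCoeffs (2 * (C ((1 - s ^ 2) / 4) : K⟦X⟧) * (1 - X) * denom X (C ((1 - s ^ 2) / 4) : K⟦X⟧) w -
      X * (1 - w) * numer X (C ((1 - s ^ 2) / 4) : K⟦X⟧) w)
      ((1 + 6 * s + 14 * s ^ 2 + 14 * s ^ 3 - 14 * s ^ 5 - 14 * s ^ 6 - 6 * s ^ 7 - s ^ 8) / 128)
      ((-3 - 11 * s - 10 * s ^ 2 + 6 * s ^ 3 + 8 * s ^ 4 - 8 * s ^ 5 - 6 * s ^ 6 + 10 * s ^ 7 + 11 * s ^ 8 + 3 * s ^ 9) / (128 * s))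
      ((-3 - s ^ 2 - 28 * s ^ 3 + 18 * s ^ 4 + 96 * s ^ 5 - 18 * s ^ 6 - 120 * s ^ 7 + s ^ 8 + 64 * s ^ 9 + 3 * s ^ 10 - 12 * s ^ 11) / (512 * s ^ 3))
      ((-3 - 4 * s ^ 2 - 7 * s ^ 4 - 88 * s ^ 5 + 256 * s ^ 6 + 192 * s ^ 7 - 577 * s ^ 8 - 112 * s ^ 9 + 452 * s ^ 10 - 117 * s ^ 12 + 8 * s ^ 13) / (1024 * s ^ 5)) := by
    refine ((((h2.mul hx).mul (h1.sub hX)).mul hD).sub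
      ((mul_assoc (X : K⟦X⟧) (1 - w) (numer X (C ((1 - s ^ 2) / 4) : K⟦X⟧) w)).symm ▸ hX.mul hM)).congr ?_ ?_ ?_ ?_ <;> field_simp <;> ring
  refine hA.eq_of_mul_eq hB h ?_ ?_ ?_ ?_ ?_
  · have : (s + 7 * s ^ 2 + 21 * s ^ 3 + 35 * s ^ 4 + 35 * s ^ 5 + 21 * s ^ 6 + 7 * s ^ 7 + s ^ 8) / 128 = s * (1 + s) ^ 7 / 128 := by ring
    rw [this]
    exact div_ne_zero (mul_ne_zero hs (pow_ne_zero 7 hs1)) (by norm_num)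
  all_goals
    field_simp
    ring

end Coefficients

/-! ### From truncated sums to the generating function in `x` and `q` -/

theorem map_rankSum {R S : Type*} [CommRing R] [CommRing S] (f : R →+* S) (q : R) (k i : ℕ) :
    f (rankSum q k i) = rankSum (f q) k i := by
  induction k generalizing i with
  | zero => simp [rankSum]
  | succ k ih =>
    simp only [rankSum, map_sum, map_mul, apply_ite f, map_pow, map_one, map_ofNat, ih]

theorem map_denom {R S : Type*} [CommRing R] [CommRing S] (f : R →+* S) (q x w : R) :
    f (denom q x w) = denom (f q) (f x) (f w) := by
  simp only [denom, map_sub, map_add, map_mul, map_pow, map_one, map_ofNat]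

theorem map_numer {R S : Type*} [CommRing R] [CommRing S] (f : R →+* S) (q x w : R) :
    f (numer q x w) = numer (f q) (f x) (f w) := by
  simp only [numer, map_sub, map_add, map_mul, map_pow, map_ofNat]

/-- The generating function `∑_{n ≥ 1, r} count (n + 1) r * x ^ n * q ^ r`, as a power series
in `q` whose coefficients are power series in `x`. -/
noncomputable def countSeries : ℚ⟦X⟧⟦X⟧ :=
  PowerSeries.mk fun r => PowerSeries.mk fun n => if 1 ≤ n then (count (n + 1) r : ℚ) else 0

theorem exists_countSeries_eq (N : ℕ) : ∃ e : ℚ⟦X⟧⟦X⟧, countSeries =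
    ∑ k ∈ Finset.range N, C X ^ (k + 1) * rankSum X (k + 1) 0 + C X ^ (N + 1) * e := by
  refine ⟨PowerSeries.mk fun r => PowerSeries.mk fun n => (count (n + N + 2) r : ℚ), ?_⟩
  ext r n
  rw [map_add, map_sum, map_add, map_sum, ← map_pow, coeff_C_mul, countSeries, coeff_mk, coeff_mk,
    coeff_mk, coeff_X_pow_mul', coeff_mk]
  have h : ∀ k ∈ Finset.range N, coeff n (coeff r (C X ^ (k + 1) *
      rankSum (X : ℚ⟦X⟧⟦X⟧) (k + 1) 0)) = if n = k + 1 then (count (n + 1) r : ℚ) else 0 := by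
    intro k _
    rw [← map_pow, coeff_C_mul, coeff_rankSum_X, ← map_natCast (C (R := ℚ)), mul_comm,
      coeff_C_mul, coeff_X_pow]
    split_ifs with h
    · rw [h, mul_one]
    · rw [mul_zero]
  rw [Finset.sum_congr rfl h]
  rcases n with _ | n
  · simp
  · by_cases hn : n < N
    · rw [if_pos (by omega), if_neg (by omega), Finset.sum_eq_single n]
      · simp
      · intro k _ hk
        rw [if_neg (by omega)]
      · intro h'
        exact absurd (Finset.mem_range.mpr hn) h'
    · rw [if_pos (by omega), if_pos (by omega), Finset.sum_eq_zero, zero_add,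
        show n + 1 - (N + 1) + N + 2 = n + 1 + 1 by omega]
      intro k hk
      have := Finset.mem_range.mp hk
      rw [if_neg (by omega)]

/-- Here the outer variable `X` is `q` and `C X` is `x`. The kernel method is applied in the
quotient by `q ^ 4` and `x ^ (N + 4)` for every `N`. There `w` need only satisfy its equation modulo
`q ^ 4`. -/
theorem kernel_countSeries {w e : ℚ⟦X⟧⟦X⟧} (hu : IsUnit w)
    (hw : (1 - w) * (w - X) = C X * (1 - X) + X ^ 4 * e) (d : ℕ) (hd : d < 4) :
    coeff d ((2 * w - 1) * (w - X) * denom X (C X) w * countSeries) =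
      coeff d (2 * C X * (1 - X) * denom X (C X) w - X * (1 - w) * numer X (C X) w) := by
  rw [← sub_eq_zero, ← map_sub]
  set L := (2 * w - 1) * (w - X) * denom X (C X) w * countSeries -
    (2 * C X * (1 - X) * denom X (C X) w - X * (1 - w) * numer X (C X) w) with hL
  have key : ∀ N : ℕ, (X : ℚ⟦X⟧) ^ (N + 4) ∣ X * coeff d L := by
    intro N
    set I : Ideal ℚ⟦X⟧⟦X⟧ := Ideal.span {X ^ 4, C X ^ (N + 4)} with hI
    let φ := Ideal.Quotient.mk I
    have hq : φ X ^ 4 = 0 := by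
      rw [← map_pow]
      exact Ideal.Quotient.eq_zero_iff_mem.mpr (Ideal.subset_span (by simp))
    have hx : φ (C X) ^ (N + 4) = 0 := by
      rw [← map_pow]
      exact Ideal.Quotient.eq_zero_iff_mem.mpr (Ideal.subset_span (by simp))
    obtain ⟨v, hv⟩ := hu.exists_right_inv
    have h1 := kernel_method hq N hx (v := φ v) (w := φ w) (by rw [← map_mul, hv, map_one])
      (by simpa [hq] using congrArg φ hw)
    obtain ⟨e', he'⟩ := exists_countSeries_eq (N + 3)
    have h2 : φ countSeries = ∑ k ∈ Finset.range (N + 3),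
        φ (C X) ^ (k + 1) * rankSum (φ X) (k + 1) 0 := by
      rw [he', map_add, map_mul, map_pow, hx, zero_mul, add_zero, map_sum]
      simp [map_rankSum]
    have h3 : φ (C X * L) = 0 := by
      rw [hL]
      simp only [map_mul, map_sub, map_one, map_ofNat, map_denom, map_numer, h2]
      linear_combination h1
    obtain ⟨a, b, hab⟩ := Ideal.mem_span_pair.mp (Ideal.Quotient.eq_zero_iff_mem.mp h3)
    have h4 := congrArg (coeff d) hab
    rw [map_add, coeff_C_mul, coeff_mul_X_pow', if_neg (by omega), zero_add, ← map_pow,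
      mul_comm, coeff_C_mul] at h4
    exact ⟨_, h4.symm⟩
  -- Divisibility by every power of `x` forces zero, and in the domain `ℚ⟦X⟧` the leftover factor
  -- `x` can at last be cancelled.
  have h0 : X * coeff d L = 0 := by
    ext n
    exact X_pow_dvd_iff.mp (key n) n (by omega)
  exact (mul_eq_zero.mp h0).resolve_left X_ne_zero

theorem constantCoeff_one_sub_four_mul_X : constantCoeff (1 - 4 * X : ℚ⟦X⟧) = 1 := by simp

theorem eq_of_mul_self_eq {f g : ℚ⟦X⟧} (hf : constantCoeff f = 1) (hg : constantCoeff g = 1)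
    (h : f * f = g * g) : f = g := by
  rcases mul_self_eq_mul_self_iff.mp h with h | h
  · exact h
  · rw [h, map_neg, hg] at hf
    norm_num at hf

theorem sqrtSeries_pow {f : ℚ⟦X⟧} (hf : constantCoeff f = 1) (n : ℕ) :
    sqrtSeries (f ^ n) = sqrtSeries f ^ n := by
  have hn : constantCoeff (f ^ n) = 1 := by rw [map_pow, hf, one_pow]
  refine eq_of_mul_self_eq (constantCoeff_sqrtSeries hn) ?_ ?_
  · rw [map_pow, constantCoeff_sqrtSeries hf, one_pow]
  · rw [sqrtSeries_mul_self hn, ← mul_pow, sqrtSeries_mul_self hf]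

instance charZero_laurentSeries : CharZero ℚ⸨X⸩ :=
  charZero_of_injective_algebraMap (algebraMap ℚ ℚ⸨X⸩).injective

theorem coe_sqrtSeries {s : ℚ⸨X⸩} (hs : s = (sqrtSeries (1 - 4 * X) : ℚ⸨X⸩)) :
    s ≠ 0 ∧ 1 + s ≠ 0 ∧ ((X : ℚ⟦X⟧) : ℚ⸨X⸩) = (1 - s ^ 2) / 4 := by
  set ι : ℚ⟦X⟧ →+* ℚ⸨X⸩ := HahnSeries.ofPowerSeries ℤ ℚ with hι
  have hinj : Function.Injective ι := HahnSeries.ofPowerSeries_injective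
  set t := sqrtSeries (1 - 4 * X) with ht
  have htt : t * t = 1 - 4 * X := sqrtSeries_mul_self constantCoeff_one_sub_four_mul_X
  have ht0 : constantCoeff t = 1 := constantCoeff_sqrtSeries constantCoeff_one_sub_four_mul_X
  have hs0 : s ≠ 0 := by
    rw [hs]
    refine (map_ne_zero_iff ι hinj).mpr fun h => ?_
    rw [h] at ht0
    simp at ht0
  have hs1 : 1 + s ≠ 0 := by
    rw [hs, ← map_one ι, ← map_add]
    refine (map_ne_zero_iff ι hinj).mpr fun h => ?_
    have h' := congrArg constantCoeff h
    rw [map_add, ht0] at h'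
    norm_num at h'
  have hx : ι X = (1 - s ^ 2) / 4 := by
    have h := congrArg ι htt
    rw [map_mul, map_sub, map_mul, map_one, map_ofNat, ← hs] at h
    linear_combination (1 / 4 : ℚ⸨X⸩) * h
  exact ⟨hs0, hs1, hx⟩

theorem coe_countSeries {s : ℚ⸨X⸩} (hs : s = (sqrtSeries (1 - 4 * X) : ℚ⸨X⸩)) :
    HasCoeffs (PowerSeries.map (HahnSeries.ofPowerSeries ℤ ℚ) countSeries)
      ((1 - s) / s)
      ((1 - 6 * s ^ 2 + 8 * s ^ 3 - 3 * s ^ 4) / (2 * s ^ 3 * (1 + s) ^ 2))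
      ((3 - 2 * s - 11 * s ^ 2 + 4 * s ^ 3 + 29 * s ^ 4 - 34 * s ^ 5 + 11 * s ^ 6) /
        (8 * s ^ 5 * (1 + s) ^ 2))
      ((5 - s - 18 * s ^ 2 + 2 * s ^ 3 + 40 * s ^ 5 + 66 * s ^ 6 - 242 * s ^ 7 + 203 * s ^ 8 -
        55 * s ^ 9) / (16 * s ^ 7 * (1 + s) ^ 3)) := by
  set ι : ℚ⟦X⟧ →+* ℚ⸨X⸩ := HahnSeries.ofPowerSeries ℤ ℚ with hι
  have hinj : Function.Injective ι := HahnSeries.ofPowerSeries_injective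
  set t := sqrtSeries (1 - 4 * X) with ht
  have ht0 : constantCoeff t = 1 := constantCoeff_sqrtSeries constantCoeff_one_sub_four_mul_X
  obtain ⟨hs0, hs1, hx⟩ := coe_sqrtSeries hs
  have hti : ι t⁻¹ = s⁻¹ := by
    have h := congrArg ι (PowerSeries.mul_inv_cancel t (by rw [ht0]; exact one_ne_zero))
    rw [map_mul, map_one, ← hs] at h
    exact eq_inv_of_mul_eq_one_right h
  have hu : ι (C (1 / 2)) = 1 / 2 := by
    have h := congrArg ι (congrArg (C (R := ℚ)) (show (1 / 2 : ℚ) * 2 = 1 by norm_num))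
    rw [map_mul, map_mul, map_ofNat, map_ofNat, map_one, map_one] at h
    linear_combination h / 2
  set u : ℚ⟦X⟧ := C (1 / 2) with hu_def
  -- The expansion through `q ^ 3` of the root of `(1 - w) * (w - q) = x * (1 - q)` on the branch
  -- `(1 + t) / 2`, the invertible one. Writing it with `u = 1 / 2` and `t⁻¹` keeps the coefficients
  -- in `ℚ⟦X⟧`, as `kernel_countSeries` demands.
  let w : ℚ⟦X⟧⟦X⟧ := C (u * (1 + t)) - C (u ^ 2 * t⁻¹ * (1 - t) ^ 2) * X -
    C (u ^ 4 * t⁻¹ ^ 3 * (1 - t ^ 2) ^ 2) * X ^ 2 -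
    C (u ^ 5 * t⁻¹ ^ 5 * (1 + t ^ 2) * (1 - t ^ 2) ^ 2) * X ^ 3
  have hwc : HasCoeffs (PowerSeries.map ι w)
      ((1 + s) / 2)
      ((-1 + 2 * s - s ^ 2) / (4 * s))
      ((-1 + 2 * s ^ 2 - s ^ 4) / (16 * s ^ 3))
      ((-1 + s ^ 2 + s ^ 4 - s ^ 6) / (32 * s ^ 5)) := by
    refine ⟨?_, ?_, ?_, ?_⟩ <;> rw [coeff_map] <;>
      simp only [w, map_sub, coeff_C_mul, coeff_C, coeff_X, coeff_X_pow] <;>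
      simp [hti, hu, ← hs] <;> field_simp <;> ring
  have hwu : IsUnit w := by
    rw [isUnit_iff_constantCoeff, isUnit_iff_constantCoeff]
    have h1 : constantCoeff (constantCoeff w) = 1 := by
      simp [w, ht0, hu_def]
      norm_num
    rw [h1]
    exact isUnit_one
  obtain ⟨e, he⟩ : X ^ 4 ∣ (1 - w) * (w - X) - C X * (1 - X) := by
    have hX := HasCoeffs.variable_X (K := ℚ⸨X⸩)
    have h1 := HasCoeffs.one (K := ℚ⸨X⸩)
    have hc : HasCoeffs ((1 - PowerSeries.map ι w) * (PowerSeries.map ι w - X) -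
        C (ι X) * (1 - X)) 0 0 0 0 := by
      rw [hx]
      refine (((h1.sub hwc).mul (hwc.sub hX)).sub
        ((HasCoeffs.const _).mul (h1.sub hX))).congr ?_ ?_ ?_ ?_ <;> field_simp <;> ring
    have hm : PowerSeries.map ι ((1 - w) * (w - X) - C X * (1 - X)) =
        (1 - PowerSeries.map ι w) * (PowerSeries.map ι w - X) - C (ι X) * (1 - X) := by
      simp only [map_sub, map_mul, map_one, PowerSeries.map_X, PowerSeries.map_C]
    rw [← hm] at hc
    obtain ⟨c0, c1, c2, c3⟩ := hc
    rw [coeff_map] at c0 c1 c2 c3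
    refine X_pow_dvd_iff.mpr fun m hm => hinj ?_
    rw [map_zero]
    interval_cases m <;> assumption
  refine hasCoeffs_of_kernel hs0 hs1 hx hwc fun d hd => ?_
  have h := congrArg ι (kernel_countSeries hwu (sub_eq_iff_eq_add'.mp he) d hd)
  rw [← coeff_map, ← coeff_map] at h
  simpa only [map_sub, map_mul, map_one, map_ofNat, PowerSeries.map_X, PowerSeries.map_C,
    map_denom, map_numer] using h

/-! ### The term `n = 2` and the final identities -/

theorem count_two (r : ℕ) : count 2 r = if r = 0 then 2 else 0 := by
  have h : coeff r (rankSum (X : ℚ⟦X⟧⟦X⟧) 1 0) = (count 2 r : ℚ⟦X⟧) := coeff_rankSum_X 1 r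
  have h2 : rankSum (X : ℚ⟦X⟧⟦X⟧) 1 0 = C 2 := by
    rw [map_ofNat]
    simp [rankSum]
  rw [← map_natCast (C (R := ℚ))] at h
  rw [h2, coeff_C] at h
  split_ifs at h ⊢ with hr
  · rw [← map_ofNat (C (R := ℚ))] at h
    exact_mod_cast (C_injective h).symm
  · rw [← map_zero (C (R := ℚ))] at h
    exact_mod_cast (C_injective h).symm

theorem genFun_two (r : ℕ) : genFun 2 r = X * coeff r countSeries := by
  ext n
  rcases n with _ | n
  · simp [genFun]
  · rw [coeff_succ_X_mul, genFun, countSeries, coeff_mk, coeff_mk, coeff_mk]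
    simp only [show 2 ≤ n + 1 ↔ 1 ≤ n by omega]

theorem genFun_three (r : ℕ) : genFun 3 r = genFun 2 r - C (count 2 r : ℚ) * X ^ 2 := by
  ext n
  rw [map_sub, coeff_C_mul, coeff_X_pow, genFun, genFun, coeff_mk, coeff_mk]
  rcases lt_trichotomy n 2 with h | rfl | h
  · rw [if_neg (by omega), if_neg (by omega), if_neg (by omega)]; simp
  · simp
  · rw [if_pos (by omega), if_pos (by omega), if_neg (by omega)]; simp

theorem genFun_two_eq_genFun_three {r : ℕ} (hr : r ≠ 0) : genFun 2 r = genFun 3 r := by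
  rw [genFun_three, count_two, if_neg hr]
  simp

end Flatten

theorem mainTheorem12 (r : Fin 4) :
    ((Flatten.genFun 3 r : ℚ⟦X⟧) : ℚ⸨X⸩) =
        ((Flatten.a r : ℚ⸨X⸩) +
            (Flatten.b r : ℚ⸨X⸩) * (Flatten.sqrtSeries (1 - 4 * X) : ℚ⸨X⸩)) /
          (Flatten.sqrtSeries ((1 - 4 * X) ^ (2 * (r : ℕ) + 1)) : ℚ⸨X⸩) ∧
      (1 ≤ r → Flatten.genFun 2 r = Flatten.genFun 3 r) := by
  constructor
  · rw [Flatten.sqrtSeries_pow Flatten.constantCoeff_one_sub_four_mul_X, map_pow,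
      Flatten.genFun_three, Flatten.genFun_two]
    obtain ⟨g0, g1, g2, g3⟩ := Flatten.coe_countSeries rfl
    obtain ⟨hs0, hs1, hx⟩ := Flatten.coe_sqrtSeries rfl
    rw [coeff_map] at g0 g1 g2 g3
    set s : ℚ⸨X⸩ := HahnSeries.ofPowerSeries ℤ ℚ (Flatten.sqrtSeries (1 - 4 * X)) with hs
    -- The functions `a` and `b` contain powers of `1 / x`, and `x = (1 - s ^ 2) / 4`; clearing
    -- denominators needs `x ≠ 0`.
    have hs2 : 1 - s ^ 2 ≠ 0 := by
      intro h
      rw [h, zero_div] at hx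
      exact X_ne_zero (HahnSeries.ofPowerSeries_injective (hx.trans (map_zero _).symm))
    have hX : ((RatFunc.X : RatFunc ℚ) : ℚ⸨X⸩) = (1 - s ^ 2) / 4 := by
      rw [← hx, PowerSeries.coe_X]
      exact RatFunc.coe_X
    fin_cases r <;>
      simp only [Flatten.count_two, Flatten.a, Flatten.b, map_sub, map_mul, map_pow, map_add,
        map_neg, map_div₀, map_one, map_ofNat, hX, hx, g0, g1, g2, g3, Fin.zero_eta, Fin.mk_one,
        Fin.reduceFinMk, Matrix.cons_val, Matrix.cons_val_zero, Matrix.cons_val_one, if_true,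
        OfNat.ofNat_ne_zero, one_ne_zero, if_false, Nat.cast_zero, map_zero, Nat.cast_ofNat] <;>
      field_simp <;> ring
  · intro hr
    refine Flatten.genFun_two_eq_genFun_three fun h => ?_
    rw [Fin.le_def, h] at hr
    exact absurd hr (by norm_num)
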